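/- Let $\alpha\ge 2$, $\varepsilon\ge 0$, $r\ge 0$ and $\ell,t\ge 1$ be integers, let $1\le h\le \alpha\ell+\varepsilon$ be an integer, and let $q$ be a prime power. The generalized combination network $(\varepsilon,\ell)$-$\mathcal N_{h,r,\alpha\ell+\varepsilon}$ is the three-layer multicast network consisting of a source holding $h$ messages, $r$ middle nodes, and one receiver for every $\alpha$-element subset of the middle nodes; there are $\ell$ parallel links from the source to each middle node, $\ell$ parallel links from each middle node of the subset to the corresponding receiver, and $\varepsilon$ parallel direct links from the source to each receiver. Each receiver demands all $h$ messages. A $(q,t)$-linear solution is a choice, where the messages and the symbols carried by the links are vectors in $\mathbb F_q^t$, of an $\mathbb F_q$-linear function (given by coding coefficients that are $t\times t$ matrices over $\mathbb F_q$) for every link, mapping the source messages (if the link leaves the source) or the symbols entering its tail (otherwise) to the symbol it carries, such that every receiver can recover all $h$ messages from the symbols it receives by an $\mathbb F_q$-linear map. Let $\gamma_0=\prod_{i\ge 1}(1-2^{-i})^{-1}\approx 3.4627$, which is the least constant $\gamma$ such that the Gaussian binomial coefficients satisfy $\binom{n}{k}_q<\gamma\, q^{k(n-k)}$ for all prime powers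 $q$ and all integers $0\le k\le n$. Let $\gamma\ge\gamma_0$ be any real number (for instance $\gamma=3.48$), and put $$\beta=\left(\frac{(\alpha-1)!}{2e\gamma\alpha}\right)^{\frac1{\alpha-1}},\qquad f(t)=(\alpha\ell+\varepsilon-h)\,\varepsilon t^2+(\alpha\ell+2\varepsilon-h)\,t+1 .$$ If $r\le \beta\, q^{f(t)/(\alpha-1)}$, then the network $(\varepsilon,\ell)$-$\mathcal N_{h,r,\alpha\ell+\varepsilon}$ has a $(q,t)$-linear solution. -/

import Mathlib

/-- A single-source multicast network: a directed multigraph (links may be parallel) with a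
source, which holds `messages` source messages, and a set of receivers, each of which demands
all the source messages. -/
structure MulticastNetwork where
  Node : Type
  Edge : Type
  tail : Edge → Node
  head : Edge → Node
  source : Node
  receivers : Set Node
  messages : ℕ

namespace MulticastNetwork

/-- The incoming links of a node. -/
abbrev In (N : MulticastNetwork) (v : N.Node) : Type := {e : N.Edge // N.head e = v}

/-- A vector-linear network code of vector length `t` over the field `F` that solves the
(acyclic) network `N`. Source messages and link symbols are vectors in `F ^ t`; an `F`-linear map
from a finite family of such vectors to `F ^ t` is the same thing as a family of `t × t`
coding-coefficient matrices. -/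
structure LinearSolution (N : MulticastNetwork) (F : Type*) [Field F] (t : ℕ) where
  /-- the function of the source messages sent on each link that leaves the source -/
  src : ∀ e : N.Edge, N.tail e = N.source →
    ((Fin N.messages → Fin t → F) →ₗ[F] (Fin t → F))
  /-- the function of the symbols entering a non-source node sent on each link that leaves it -/
  loc : ∀ e : N.Edge, N.tail e ≠ N.source →
    ((N.In (N.tail e) → Fin t → F) →ₗ[F] (Fin t → F))
  /-- the decoder of each receiver -/
  dec : ∀ v : N.Node, v ∈ N.receivers →
    ((N.In v → Fin t → F) →ₗ[F] (Fin N.messages → Fin t → F))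
  /-- `flow x e` is the symbol carried by the link `e` when the source messages are `x` -/
  flow : (Fin N.messages → Fin t → F) → N.Edge → (Fin t → F)
  flow_src : ∀ x e (he : N.tail e = N.source), flow x e = src e he x
  flow_loc : ∀ x e (he : N.tail e ≠ N.source), flow x e = loc e he (fun e' => flow x e'.1)
  recover : ∀ x v (hv : v ∈ N.receivers), dec v hv (fun e => flow x e.1) = x

/-- With `q` the number of elements of the finite field `F`, this says that `N` has
a `(q, t)`-linear solution. -/
def HasLinearSolution (N : MulticastNetwork) (F : Type*) [Field F] (t : ℕ) : Prop :=
  Nonempty (N.LinearSolution F t)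

end MulticastNetwork

namespace GenCombNetwork

/-- The receivers: one for each set of `α` of the `r` middle nodes. -/
abbrev Receiver (α r : ℕ) : Type := {S : Finset (Fin r) // S.card = α}

/-- The nodes: the source, `r` middle nodes, and the receivers. -/
inductive Node (α r : ℕ) : Type
  | source : Node α r
  | middle (i : Fin r) : Node α r
  | receiver (S : Receiver α r) : Node α r

/-- The links: `ℓ` parallel links from the source to each middle node, `ℓ` parallel links from
each middle node `i` to each receiver `S` with `i ∈ S`, and `ε` direct links from the source to
each receiver. -/
inductive Edge (ε ℓ α r : ℕ) : Type
  | toMiddle (i : Fin r) (j : Fin ℓ) : Edge ε ℓ α r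
  | toReceiver (S : Receiver α r) (i : Fin r) (hi : i ∈ S.1) (j : Fin ℓ) : Edge ε ℓ α r
  | direct (S : Receiver α r) (j : Fin ε) : Edge ε ℓ α r

/-- The node that a link leaves. -/
def Edge.tail {ε ℓ α r : ℕ} : Edge ε ℓ α r → Node α r
  | .toMiddle _ _ => .source
  | .toReceiver _ i _ _ => .middle i
  | .direct _ _ => .source

/-- The node that a link enters. -/
def Edge.head {ε ℓ α r : ℕ} : Edge ε ℓ α r → Node α r
  | .toMiddle i _ => .middle i
  | .toReceiver S _ _ _ => .receiver S
  | .direct S _ => .receiver S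

end GenCombNetwork

/-- The `(ε, ℓ)`-`N_{h, r, αℓ+ε}` generalized combination network. -/
def genCombNetwork (ε ℓ h r α : ℕ) : MulticastNetwork where
  Node := GenCombNetwork.Node α r
  Edge := GenCombNetwork.Edge ε ℓ α r
  tail := GenCombNetwork.Edge.tail
  head := GenCombNetwork.Edge.head
  source := .source
  receivers := Set.range .receiver
  messages := h

/-- The constant `∏_{i ≥ 1} (1 - 2^{-i})⁻¹ = 3.4627…`, the least `γ` for which the Gaussian binomial
coefficients satisfy `[n choose k]_q < γ * q ^ (k * (n - k))` for all `q ≥ 2` and `k ≤ n`. -/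
noncomputable def gaussConst : ℝ := (∏' i : ℕ, (1 - (1 / 2 : ℝ) ^ (i + 1)))⁻¹

theorem gaussConst_lt : gaussConst < 3.48 := by
  have hmul : Multipliable fun i : ℕ => (1 - (1 / 2 : ℝ) ^ (i + 1)) := by
    have hs : Summable fun i : ℕ => ‖-(1 / 2 : ℝ) ^ (i + 1)‖ := by
      simp only [norm_neg, norm_pow]
      exact (summable_nat_add_iff 1).2 (summable_geometric_of_lt_one (norm_nonneg _) (by norm_num))
    simpa [sub_eq_add_neg] using multipliable_one_add_of_summable hs
  have hpos : ∀ n : ℕ, 0 ≤ ∏ i ∈ Finset.range n, (1 - (1 / 2 : ℝ) ^ (i + 1)) := fun n =>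
    Finset.prod_nonneg fun i _ => sub_nonneg.2 (pow_le_one₀ (by norm_num) (by norm_num))
  have key : ∀ n : ℕ, (0.288 : ℝ) ≤
      (∏ i ∈ Finset.range (n + 10), (1 - (1 / 2 : ℝ) ^ (i + 1))) * (1 - (1 / 2) ^ (n + 10)) := by
    intro n
    induction n with
    | zero => norm_num [Finset.prod_range_succ]
    | succ k ih =>
      refine ih.trans ?_
      rw [show k + 1 + 10 = (k + 10) + 1 by ring, Finset.prod_range_succ _ (k + 10), mul_assoc]
      refine mul_le_mul_of_nonneg_left ?_ (hpos _)
      rw [pow_succ (1 / 2 : ℝ) (k + 10)]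
      nlinarith [sq_nonneg ((1 / 2 : ℝ) ^ (k + 10))]
  have hlim := (Filter.tendsto_add_atTop_iff_nat 10).2 hmul.hasProd.tendsto_prod_nat
  have hge : (0.288 : ℝ) ≤ ∏' i : ℕ, (1 - (1 / 2 : ℝ) ^ (i + 1)) := by
    refine ge_of_tendsto' hlim fun n => (key n).trans ?_
    refine mul_le_of_le_one_right (hpos _) ?_
    have : (0 : ℝ) ≤ (1 / 2) ^ (n + 10) := by positivity
    linarith
  unfold gaussConst
  rw [inv_lt_comm₀ (by linarith) (by norm_num)]
  exact lt_of_lt_of_le (by norm_num) hge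

/-- `β = ((α-1)! / (2eγα))^{1/(α-1)}`. -/
noncomputable def middleBeta (γ : ℝ) (α : ℕ) : ℝ :=
  ((Nat.factorial (α - 1) : ℝ) / (2 * Real.exp 1 * γ * α)) ^ (1 / ((α : ℝ) - 1))

/-- `f(t) = (αℓ+ε-h)εt² + (αℓ+2ε-h)t + 1`. -/
def middleExponent (α ℓ ε h t : ℕ) : ℝ :=
  ((α : ℝ) * ℓ + ε - h) * ε * (t : ℝ) ^ 2 + ((α : ℝ) * ℓ + 2 * ε - h) * t + 1

/-! Let each middle node `i` receive `A i x`, with `A i` a uniformly random linear map F^(ht) →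
F^(ℓt), and forward it. A receiver `S` can be served as soon as the common kernel of the `A i`, `i ∈
S`, has dimension at most `ε * t`: the direct links then carry a map injective on that kernel
(`hasLinearSolution_of_finrank_le`).

Call `S` bad if this dimension is at least `k = ε * t + 1`. Double counting pairs of a family `A`
and an independent `k`-tuple in its common kernel bounds the probability of this by γ / q^f(t)
(`card_le_finrank_iInf_ker_mul_pow_le`).

Bad events of disjoint sets are independent, so a local lemma applies. In the counting form
`exists_forall_not_bad`, each new middle node keeps at least a fraction `y` of the good families.
With `y = 1 - 1/α` its condition follows from the bound on `r`. -/

/-! ### A local lemma by counting. -/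

section Counting

variable {ι M : Type*} [Fintype ι] [DecidableEq ι] [Fintype M]

open Classical in
/-- Two events that depend on disjoint sets of coordinates are (sub)independent. -/
theorem card_and_mul_card_le (S : Finset ι) (P Q : (ι → M) → Prop)
    (hP : ∀ A A', (∀ i ∉ S, A i = A' i) → P A → P A')
    (hQ : ∀ A A', (∀ i ∈ S, A i = A' i) → Q A → Q A') :
    Fintype.card {A : ι → M // P A ∧ Q A} * Fintype.card (ι → M) ≤
      Fintype.card {A : ι → M // P A} * Fintype.card {A : ι → M // Q A} := by
  rw [← Fintype.card_prod, ← Fintype.card_prod]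
  -- Swap the coordinates in `S` between the two families: `P` ignores them and `Q` sees nothing
  -- else. The swap is reversible.
  refine Fintype.card_le_of_injective
    (fun x => (⟨S.piecewise x.2 x.1.1, hP _ _ (fun i hi => by simp [hi]) x.1.2.1⟩,
      ⟨S.piecewise x.1.1 x.2, hQ _ _ (fun i hi => by simp [hi]) x.1.2.2⟩)) ?_
  rintro ⟨⟨a, ha⟩, b⟩ ⟨⟨a', ha'⟩, b'⟩ h
  simp only [Prod.mk.injEq, Subtype.mk.injEq, funext_iff, Finset.piecewise] at h
  have h1 : a = a' := by
    funext i
    by_cases hi : i ∈ S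
    · simpa [hi] using h.2 i
    · simpa [hi] using h.1 i
  have h2 : b = b' := by
    funext i
    by_cases hi : i ∈ S
    · simpa [hi] using h.1 i
    · simpa [hi] using h.2 i
  subst h1 h2
  rfl

/-- No bad event occurs on an `a`-element subset of `X`. -/
def Avoids (a : ℕ) (Bad : Finset ι → (ι → M) → Prop) (X : Finset ι) (A : ι → M) : Prop :=
  ∀ S ⊆ X, S.card = a → ¬ Bad S A

open Classical in
-- A family lost on adding `v` has a bad set `insert v T` with `T ⊆ X`. Weakening avoidance on `X`
-- to avoidance on `X \ T`, which is disjoint from `insert v T`, makes the two conditions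
-- independent. The factor `card (ι → M)` clears the denominators of the probabilities.
theorem card_avoids_insert (a : ℕ) (Bad : Finset ι → (ι → M) → Prop)
    (hloc : ∀ S A A', (∀ i ∈ S, A i = A' i) → Bad S A → Bad S A')
    (X : Finset ι) (v : ι) (hv : v ∉ X) :
    Fintype.card {A // Avoids a Bad X A} * Fintype.card (ι → M) ≤
      Fintype.card {A // Avoids a Bad (insert v X) A} * Fintype.card (ι → M) +
        ∑ T ∈ X.powersetCard (a - 1), Fintype.card {A // Avoids a Bad (X \ T) A} *
          Fintype.card {A // Bad (insert v T) A} := by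
  have key : Fintype.card {A // Avoids a Bad X A} ≤
      Fintype.card {A // Avoids a Bad (insert v X) A} +
        ∑ T ∈ X.powersetCard (a - 1),
          Fintype.card {A // Avoids a Bad (X \ T) A ∧ Bad (insert v T) A} := by
    simp only [Fintype.card_subtype]
    refine (Finset.card_le_card (t := Finset.univ.filter (Avoids a Bad (insert v X)) ∪
      (X.powersetCard (a - 1)).biUnion fun T =>
        Finset.univ.filter fun A => Avoids a Bad (X \ T) A ∧ Bad (insert v T) A) ?_).trans
      ((Finset.card_union_le _ _).trans (Nat.add_le_add_left Finset.card_biUnion_le _))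
    intro A hA
    have hA' : Avoids a Bad X A := by simpa using hA
    by_cases hG : Avoids a Bad (insert v X) A
    · simp [hG]
    · obtain ⟨S, hS, hc, hB⟩ : ∃ S ⊆ insert v X, S.card = a ∧ Bad S A := by
        simpa [Avoids] using hG
      have hvS : v ∈ S := by
        by_contra hvS
        refine hA' S (fun i hi => ?_) hc hB
        rcases Finset.mem_insert.1 (hS hi) with rfl | h
        · exact absurd hi hvS
        · exact h
      refine Finset.mem_union_right _ (Finset.mem_biUnion.2 ⟨S.erase v, ?_, ?_⟩)
      · refine Finset.mem_powersetCard.2 ⟨?_, by rw [Finset.card_erase_of_mem hvS, hc]⟩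
        rw [← Finset.erase_insert hv]
        exact Finset.erase_subset_erase _ hS
      · simp only [Finset.mem_filter, Finset.mem_univ, true_and, Finset.insert_erase hvS]
        exact ⟨fun T hT => hA' T (hT.trans Finset.sdiff_subset), hB⟩
  refine (Nat.mul_le_mul_right _ key).trans ?_
  rw [add_mul, Finset.sum_mul]
  refine Nat.add_le_add_left (Finset.sum_le_sum fun T _ => ?_) _
  refine card_and_mul_card_le (insert v T) _ _ ?_ (hloc _)
  intro A A' hAA hA S hS hc hB
  refine hA S hS hc (hloc S A' A (fun i hi => (hAA i ?_).symm) hB)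
  have := Finset.mem_sdiff.1 (hS hi)
  simp only [Finset.mem_insert, not_or]
  exact ⟨fun h => hv (h ▸ this.1), this.2⟩

open Classical in
/-- Counting form of the local lemma for events indexed by the `a`-element sets of coordinates. -/
theorem exists_forall_not_bad [Nonempty M] (a : ℕ) (ha : 1 ≤ a)
    (Bad : Finset ι → (ι → M) → Prop)
    (hloc : ∀ S A A', (∀ i ∈ S, A i = A' i) → Bad S A → Bad S A') (p y : ℝ) (hp : 0 ≤ p)
    (hbad : ∀ S, S.card = a →
      (Nat.card {A // Bad S A} : ℝ) ≤ p * Nat.card (ι → M))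
    (hy : 0 < y)
    (hpy : ((Fintype.card ι - 1).choose (a - 1) : ℝ) * p ≤ (1 - y) * y ^ (a - 1)) :
    ∃ A : ι → M, ∀ S, S.card = a → ¬ Bad S A := by
  simp only [Nat.card_eq_fintype_card] at hbad
  set N : Finset ι → ℝ := fun X => (Fintype.card {A // Avoids a Bad X A} : ℝ) with hN
  have hN0 : ∀ X, 0 ≤ N X := fun X => Nat.cast_nonneg _
  have hΩ : (0 : ℝ) < Fintype.card (ι → M) := by exact_mod_cast Fintype.card_pos
  -- Iterating the one-point bound: adding `T` costs at most a factor `y ^ T.card`.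
  have chain : ∀ n : ℕ, (∀ X : Finset ι, X.card < n → ∀ v ∉ X, y * N X ≤ N (insert v X)) →
      ∀ T X : Finset ι, Disjoint X T → X.card + T.card ≤ n → y ^ T.card * N X ≤ N (X ∪ T) := by
    intro n hn T
    induction T using Finset.induction_on with
    | empty => intro X _ _; simp
    | insert v T hvT ih =>
      intro X hd hc
      rw [Finset.card_insert_of_notMem hvT] at hc ⊢
      rw [Finset.disjoint_insert_right] at hd
      have h1 := ih X hd.2 (by omega)
      have h2 := hn (X ∪ T) (by rw [Finset.card_union_of_disjoint hd.2]; omega) v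
        (by simp [hd.1, hvT])
      rw [Finset.union_insert, pow_succ']
      nlinarith
  have step : ∀ n : ℕ, ∀ X : Finset ι, X.card < n → ∀ v ∉ X, y * N X ≤ N (insert v X) := by
    intro n
    induction n with
    | zero => intro X hX; omega
    | succ n ih =>
      intro X hX v hv
      have h1 : N X * Fintype.card (ι → M) ≤ N (insert v X) * Fintype.card (ι → M) +
          ∑ T ∈ X.powersetCard (a - 1), N (X \ T) *
            (Fintype.card {A // Bad (insert v T) A} : ℝ) := by
        simp only [hN]
        exact_mod_cast card_avoids_insert a Bad hloc X v hv
      have h2 : ∀ T ∈ X.powersetCard (a - 1), N (X \ T) *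
            (Fintype.card {A // Bad (insert v T) A} : ℝ) ≤
            N X / y ^ (a - 1) * (p * Fintype.card (ι → M)) := by
        intro T hT
        obtain ⟨hTX, hTc⟩ := Finset.mem_powersetCard.1 hT
        -- Only sets smaller than `X` occur while `T` is added back to `X \ T`, so the induction
        -- hypothesis suffices.
        have h3 := chain n ih T (X \ T) Finset.sdiff_disjoint
          (by rw [Finset.card_sdiff_of_subset hTX]; have := Finset.card_le_card hTX; omega)
        rw [Finset.sdiff_union_of_subset hTX, hTc] at h3
        refine mul_le_mul ?_ (hbad _ ?_) (Nat.cast_nonneg _) (div_nonneg (hN0 X) (by positivity))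
        · rw [le_div_iff₀ (by positivity)]
          linarith
        · rw [Finset.card_insert_of_notMem fun h => hv (hTX h), hTc]
          omega
      have h4 := Finset.sum_le_sum h2
      rw [Finset.sum_const, Finset.card_powersetCard, nsmul_eq_mul] at h4
      have hXc : X.card ≤ Fintype.card ι - 1 := by
        have := Finset.card_le_univ (insert v X)
        rw [Finset.card_insert_of_notMem hv] at this
        omega
      have h5 : (X.card.choose (a - 1) : ℝ) * p ≤ (1 - y) * y ^ (a - 1) :=
        (mul_le_mul_of_nonneg_right (by exact_mod_cast Nat.choose_le_choose _ hXc) hp).trans hpy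
      have h6 : (X.card.choose (a - 1) : ℝ) *
          (N X / y ^ (a - 1) * (p * Fintype.card (ι → M))) ≤
            (1 - y) * N X * Fintype.card (ι → M) := by
        have : (X.card.choose (a - 1) : ℝ) * (N X / y ^ (a - 1) * (p * Fintype.card (ι → M))) =
            (X.card.choose (a - 1) * p) / y ^ (a - 1) * (N X * Fintype.card (ι → M)) := by ring
        rw [this, mul_assoc (1 - y)]
        refine mul_le_mul_of_nonneg_right ?_ (mul_nonneg (hN0 X) hΩ.le)
        rwa [div_le_iff₀ (by positivity)]
      refine le_of_mul_le_mul_right ?_ hΩ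
      linarith
  have hall := chain _ (step _) Finset.univ ∅ (by simp) le_rfl
  -- Here `1 ≤ a` matters: the empty set is not an index of a bad event.
  have hempty : 0 < N ∅ := by
    have : Avoids a Bad ∅ (fun _ => Classical.arbitrary M) := by
      intro S hS hc
      rw [Finset.subset_empty.1 hS] at hc
      simp at hc
      omega
    exact Nat.cast_pos.2 (Fintype.card_pos_iff.2 ⟨⟨_, this⟩⟩)
  have hpos : 0 < N (∅ ∪ Finset.univ) := lt_of_lt_of_le (by positivity) hall
  obtain ⟨A, hA⟩ := Fintype.card_pos_iff.1 (Nat.cast_pos.1 hpos)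
  exact ⟨A, fun S hc => hA S (by simp) hc⟩

end Counting

/-! ### Counting families of maps with a large common kernel. -/

section KernelCount

variable {F : Type*} [Field F] [Fintype F]
  {V W : Type*} [AddCommGroup V] [Module F V] [Finite V] [AddCommGroup W] [Module F W] [Finite W]

open Module

theorem card_linearMap_le_ker (U : Submodule F V) :
    Nat.card {φ : V →ₗ[F] W // U ≤ LinearMap.ker φ} ≤
      Fintype.card F ^ ((finrank F V - finrank F U) * finrank F W) := by
  have : Finite (V ⧸ U) := Module.finite_of_finite F
  have : Finite ((V ⧸ U) →ₗ[F] W) := DFunLike.finite _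
  have hc : Nat.card ((V ⧸ U) →ₗ[F] W) =
      Fintype.card F ^ ((finrank F V - finrank F U) * finrank F W) := by
    have := Fintype.ofFinite ((V ⧸ U) →ₗ[F] W)
    rw [Nat.card_eq_fintype_card, Module.card_eq_pow_finrank (K := F), finrank_linearMap,
      Submodule.finrank_quotient]
  rw [← hc]
  refine Nat.card_le_card_of_injective (fun φ => U.liftQ φ.1 φ.2) fun φ ψ h => ?_
  ext x
  simpa using LinearMap.congr_fun h (U.mkQ x)

variable {ι : Type*} [Fintype ι] [DecidableEq ι]

theorem card_pi_linearMap_le_ker (U : Submodule F V) (S : Finset ι) :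
    Nat.card {A : ι → V →ₗ[F] W // ∀ i ∈ S, U ≤ LinearMap.ker (A i)} ≤
      Fintype.card F ^ ((finrank F V - finrank F U) * finrank F W * S.card) *
        Fintype.card F ^ (finrank F V * finrank F W * (Fintype.card ι - S.card)) := by
  have : Finite (V →ₗ[F] W) := DFunLike.finite _
  -- Taking `⊥` off `S` expresses that those coordinates are unconstrained.
  let T : ι → Submodule F V := fun i => if i ∈ S then U else ⊥
  have h1 : Nat.card {A : ι → V →ₗ[F] W // ∀ i ∈ S, U ≤ LinearMap.ker (A i)} ≤
      Nat.card (∀ i, {φ : V →ₗ[F] W // T i ≤ LinearMap.ker φ}) := by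
    refine Nat.card_le_card_of_injective (fun A i => ⟨A.1 i, ?_⟩) fun A B h => ?_
    · by_cases hi : i ∈ S
      · simpa [T, hi] using A.2 i hi
      · simp [T, hi]
    · ext i : 2
      exact congrArg Subtype.val (congrFun h i)
  refine h1.trans ?_
  rw [Nat.card_pi, ← Finset.prod_mul_prod_compl S]
  refine Nat.mul_le_mul ?_ ?_
  · rw [pow_mul]
    refine Finset.prod_le_pow_card _ _ _ fun i hi => ?_
    have h := card_linearMap_le_ker (W := W) (T i)
    have hT : T i = U := if_pos hi
    rwa [hT] at h ⊢
  · rw [pow_mul, ← Finset.card_compl]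
    refine Finset.prod_le_pow_card _ _ _ fun i hi => ?_
    have h := card_linearMap_le_ker (W := W) (T i)
    have hT : T i = ⊥ := if_neg (Finset.mem_compl.1 hi)
    rw [hT] at h ⊢
    rwa [finrank_bot, Nat.sub_zero] at h

/-- Weakened to the count of bases in dimension `k`, so that the bound is uniform over all kernels
of dimension at least `k`. -/
theorem card_linearIndependent_ge (k : ℕ) (hk : k ≤ finrank F V) :
    ∏ i : Fin k, (Fintype.card F ^ k - Fintype.card F ^ i.val) ≤
      Nat.card {s : Fin k → V // LinearIndependent F s} := by
  rw [card_linearIndependent hk]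
  exact Finset.prod_le_prod' fun i _ =>
    Nat.sub_le_sub_right (Nat.pow_le_pow_right Fintype.card_pos hk) _

/-- Double count pairs of a family `A` and an independent `k`-tuple in its common kernel. Each
counted `A` has at least the product many tuples; there are at most q^(nk) tuples, n = dim V, and
the maps indexed by `S` must all kill the span of the tuple. -/
theorem card_le_finrank_iInf_ker_mul_le (k : ℕ) (S : Finset ι) :
    Nat.card {A : ι → V →ₗ[F] W // k ≤ finrank F (⨅ i ∈ S, LinearMap.ker (A i) : Submodule F V)} *
        ∏ i : Fin k, (Fintype.card F ^ k - Fintype.card F ^ i.val) ≤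
      Fintype.card F ^ (finrank F V * k) *
      (Fintype.card F ^ ((finrank F V - k) * finrank F W * S.card) *
        Fintype.card F ^ (finrank F V * finrank F W * (Fintype.card ι - S.card))) := by
  have : Finite (V →ₗ[F] W) := DFunLike.finite _
  let K : (ι → V →ₗ[F] W) → Submodule F V := fun A => ⨅ i ∈ S, LinearMap.ker (A i)
  let X := {A : ι → V →ₗ[F] W // k ≤ finrank F (K A)}
  let Y := {s : Fin k → V // LinearIndependent F s}
  have : Fintype X := Fintype.ofFinite X
  have : Fintype Y := Fintype.ofFinite Y
  have : Fintype V := Fintype.ofFinite V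
  have hX : Nat.card X * ∏ i : Fin k, (Fintype.card F ^ k - Fintype.card F ^ i.val) ≤
      Nat.card (Σ A : X, {s : Fin k → K A.1 // LinearIndependent F s}) := by
    rw [Nat.card_sigma, Nat.card_eq_fintype_card, ← smul_eq_mul]
    exact Finset.card_nsmul_le_sum _ _ _ fun A _ => card_linearIndependent_ge k A.2
  have hY : Nat.card (Σ s : Y, {A : ι → V →ₗ[F] W //
        ∀ i ∈ S, Submodule.span F (Set.range s.1) ≤ LinearMap.ker (A i)}) ≤
      Fintype.card F ^ (finrank F V * k) *
      (Fintype.card F ^ ((finrank F V - k) * finrank F W * S.card) *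
        Fintype.card F ^ (finrank F V * finrank F W * (Fintype.card ι - S.card))) := by
    rw [Nat.card_sigma]
    refine (Finset.sum_le_card_nsmul _ _ (Fintype.card F ^ ((finrank F V - k) * finrank F W *
      S.card) * Fintype.card F ^ (finrank F V * finrank F W * (Fintype.card ι - S.card)))
      fun s _ => ?_).trans ?_
    · have h := card_pi_linearMap_le_ker (W := W) (Submodule.span F (Set.range s.1)) S
      rwa [finrank_span_eq_card s.2, Fintype.card_fin] at h
    · rw [smul_eq_mul]
      refine Nat.mul_le_mul_right _ ?_
      rw [Finset.card_univ, ← Nat.card_eq_fintype_card]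
      refine (Nat.card_le_card_of_injective (β := Fin k → V) _ Subtype.val_injective).trans ?_
      rw [Nat.card_eq_fintype_card, Fintype.card_fun, Fintype.card_fin,
        Module.card_eq_pow_finrank (K := F) (V := V), pow_mul]
  refine hX.trans (le_trans ?_ hY)
  refine Nat.card_le_card_of_injective
    (fun x => ⟨⟨fun j => (x.2.1 j : V), x.2.2.map' (K x.1.1).subtype (Submodule.ker_subtype _)⟩,
      ⟨x.1.1, fun i hi => ?_⟩⟩) ?_
  · rw [Submodule.span_le]
    rintro _ ⟨j, rfl⟩
    exact (iInf₂_le i hi : K x.1.1 ≤ _) (x.2.1 j).2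
  · rintro ⟨⟨A, hA⟩, s, hs⟩ ⟨⟨B, hB⟩, s', hs'⟩ h
    have h1 := congrArg (fun z => z.1.1) h
    have h2 : A = B := congrArg (fun z => z.2.1) h
    subst h2
    have h3 : s = s' := by
      funext j
      exact Subtype.ext (congrFun h1 j)
    subst h3
    rfl

end KernelCount

/-! ### The infinite product and the number of bases. -/

section GaussConst

open Finset

/-- Serves to keep the infinite product away from 0; the extra power of 1/2 lets the induction
close. -/
theorem quarter_add_le_prod_one_sub_half_pow (n : ℕ) :
    (1 / 4 : ℝ) + (1 / 2) ^ (n + 2) ≤ ∏ i ∈ range (n + 1), (1 - (1 / 2 : ℝ) ^ (i + 1)) := by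
  induction n with
  | zero => norm_num
  | succ n ih =>
    rw [prod_range_succ]
    have h0 : (0 : ℝ) < (1 / 2) ^ (n + 2) := by positivity
    have h1 : ((1 : ℝ) / 2) ^ (n + 2) ≤ 1 / 4 := by
      rw [pow_add]
      have : ((1 : ℝ) / 2) ^ n ≤ 1 := pow_le_one₀ (by norm_num) (by norm_num)
      linarith
    have h2 : ((1 : ℝ) / 2) ^ (n + 1 + 2) = (1 / 2) ^ (n + 2) / 2 := by ring
    have h3 : ((1 : ℝ) / 2) ^ (n + 1 + 1) = (1 / 2) ^ (n + 2) := by ring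
    rw [h2, h3]
    nlinarith

theorem one_sub_half_pow_mem (i : ℕ) :
    0 ≤ 1 - (1 / 2 : ℝ) ^ (i + 1) ∧ 1 - (1 / 2 : ℝ) ^ (i + 1) ≤ 1 := by
  have h1 : ((1 : ℝ) / 2) ^ (i + 1) ≤ 1 := pow_le_one₀ (by norm_num) (by norm_num)
  have h0 : (0 : ℝ) < (1 / 2) ^ (i + 1) := by positivity
  constructor <;> linarith

theorem tendsto_prod_one_sub_half_pow :
    Filter.Tendsto (fun n => ∏ i ∈ range n, (1 - (1 / 2 : ℝ) ^ (i + 1))) Filter.atTop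
      (nhds (∏' i : ℕ, (1 - (1 / 2 : ℝ) ^ (i + 1)))) := by
  have hmul : Multipliable fun i : ℕ => (1 - (1 / 2 : ℝ) ^ (i + 1)) := by
    have hs : Summable fun i : ℕ => ‖-(1 / 2 : ℝ) ^ (i + 1)‖ := by
      simp only [norm_neg, norm_pow]
      exact (summable_nat_add_iff 1).2 (summable_geometric_of_lt_one (norm_nonneg _) (by norm_num))
    simpa [sub_eq_add_neg] using multipliable_one_add_of_summable hs
  exact hmul.hasProd.tendsto_prod_nat

theorem gaussConst_pos : 0 < gaussConst := by
  refine inv_pos.2 (lt_of_lt_of_le (by norm_num : (0 : ℝ) < 1 / 4) ?_)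
  refine ge_of_tendsto' ((Filter.tendsto_add_atTop_iff_nat 1).2 tendsto_prod_one_sub_half_pow)
    fun n => le_trans ?_ (quarter_add_le_prod_one_sub_half_pow n)
  have h0 : (0 : ℝ) < (1 / 2) ^ (n + 2) := by positivity
  linarith

theorem inv_gaussConst_le_prod (n : ℕ) :
    gaussConst⁻¹ ≤ ∏ i ∈ range n, (1 - (1 / 2 : ℝ) ^ (i + 1)) := by
  rw [gaussConst, inv_inv]
  refine Antitone.le_of_tendsto (antitone_nat_of_succ_le fun n => ?_)
    tendsto_prod_one_sub_half_pow n
  rw [prod_range_succ]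
  exact mul_le_of_le_one_right (prod_nonneg fun i _ => (one_sub_half_pow_mem i).1)
    (one_sub_half_pow_mem n).2

/-- The number of bases of a `k`-dimensional space is at least `q ^ (k ^ 2) / gaussConst`. -/
theorem pow_sq_le_gaussConst_mul_prod (q k : ℕ) (hq : 2 ≤ q) :
    (q : ℝ) ^ (k * k) ≤ gaussConst * ((∏ i : Fin k, (q ^ k - q ^ i.val) : ℕ) : ℝ) := by
  have hq0 : (0 : ℝ) < q := by positivity
  -- Factor q^k - q^i = q^k (1 - q^(-(k-i))) and reverse the order of the factors.
  have h1 : ((∏ i : Fin k, (q ^ k - q ^ i.val) : ℕ) : ℝ) =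
      (q : ℝ) ^ (k * k) * ∏ i ∈ range k, (1 - (1 / q : ℝ) ^ (i + 1)) := by
    rw [Fin.prod_univ_eq_prod_range (fun i => q ^ k - q ^ i) k, Nat.cast_prod,
      ← prod_range_reflect (fun i => (1 - (1 / q : ℝ) ^ (i + 1))), pow_mul]
    conv_rhs => rw [← card_range k, ← prod_const, card_range, ← prod_mul_distrib]
    refine prod_congr rfl fun i hi => ?_
    have hi := mem_range.1 hi
    rw [Nat.cast_sub (Nat.pow_le_pow_right (by omega) hi.le)]
    push_cast
    have : k - 1 - i + 1 = k - i := by omega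
    rw [this, mul_sub, mul_one]
    congr 1
    rw [one_div, inv_pow, eq_mul_inv_iff_mul_eq₀ (by positivity), ← pow_add]
    congr 1
    omega
  have h2 : gaussConst⁻¹ ≤ ∏ i ∈ range k, (1 - (1 / q : ℝ) ^ (i + 1)) := by
    refine (inv_gaussConst_le_prod k).trans (prod_le_prod (fun i _ => (one_sub_half_pow_mem i).1)
      fun i _ => ?_)
    gcongr
    exact_mod_cast hq
  rw [h1]
  have h3 := mul_le_mul_of_nonneg_left h2 gaussConst_pos.le
  rw [mul_inv_cancel₀ gaussConst_pos.ne'] at h3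
  have : (0 : ℝ) < (q : ℝ) ^ (k * k) := by positivity
  nlinarith

end GaussConst

/-! ### The probability of a bad event. -/

section BadBound

open Module

variable {F : Type*} [Field F] [Fintype F]
  {V W : Type*} [AddCommGroup V] [Module F V] [Finite V] [AddCommGroup W] [Module F W] [Finite W]
  {ι : Type*} [Fintype ι] [DecidableEq ι]

/-- The double count divided by the number of bases, about q^(k²). The hypothesis `hk` keeps the
subtraction in the exponent from truncating. -/
theorem card_le_finrank_iInf_ker_mul_pow_le (k : ℕ) (S : Finset ι)
    (hk : finrank F V ≤ S.card * finrank F W + k) :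
    (Nat.card {A : ι → V →ₗ[F] W //
        k ≤ finrank F (⨅ i ∈ S, LinearMap.ker (A i) : Submodule F V)} : ℝ) *
        (Fintype.card F : ℝ) ^ (k * (S.card * finrank F W + k - finrank F V)) ≤
      gaussConst * Nat.card (ι → V →ₗ[F] W) := by
  have : Finite (V →ₗ[F] W) := DFunLike.finite _
  have := Fintype.ofFinite (V →ₗ[F] W)
  have hΩ : Nat.card (ι → V →ₗ[F] W) =
      Fintype.card F ^ (finrank F V * finrank F W * Fintype.card ι) := by
    rw [Nat.card_eq_fintype_card, Fintype.card_fun, Module.card_eq_pow_finrank (K := F),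
      finrank_linearMap, ← pow_mul]
  -- If `k` exceeds the dimension nothing is counted; otherwise `finrank F V - k` is a true
  -- difference.
  rcases lt_or_ge (finrank F V) k with hlt | hle
  · have : IsEmpty {A : ι → V →ₗ[F] W //
        k ≤ finrank F (⨅ i ∈ S, LinearMap.ker (A i) : Submodule F V)} :=
      ⟨fun A => absurd (A.2.trans (Submodule.finrank_le _)) (by omega)⟩
    rw [Nat.card_of_isEmpty, Nat.cast_zero, zero_mul]
    exact mul_nonneg gaussConst_pos.le (Nat.cast_nonneg _)
  have h1 := card_le_finrank_iInf_ker_mul_le (F := F) (V := V) (W := W) k S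
  have h2 := pow_sq_le_gaussConst_mul_prod (Fintype.card F) k Fintype.one_lt_card
  have hS := S.card_le_univ
  rw [hΩ]
  generalize Nat.card {A : ι → V →ₗ[F] W //
        k ≤ finrank F (⨅ i ∈ S, LinearMap.ker (A i) : Submodule F V)} = b at *
  generalize ∏ i : Fin k, (Fintype.card F ^ k - Fintype.card F ^ i.val) = c at *
  have hq : 0 < Fintype.card F := Fintype.card_pos
  generalize Fintype.card F = q at *
  generalize finrank F V = n at *
  generalize finrank F W = w at *
  generalize S.card = a at *
  generalize Fintype.card ι = r at *
  obtain ⟨d, rfl⟩ := Nat.exists_eq_add_of_le hle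
  obtain ⟨s, rfl⟩ := Nat.exists_eq_add_of_le hS
  have hexp : k * (a * w + k - (k + d)) + ((k + d) * k +
      ((k + d - k) * w * a + (k + d) * w * (a + s - a))) = k * k + (k + d) * w * (a + s) := by
    obtain ⟨e, he⟩ := Nat.exists_eq_add_of_le hk
    rw [he, Nat.add_sub_cancel_left, Nat.add_sub_cancel_left, Nat.add_sub_cancel_left]
    obtain rfl : e = a * w - d := by omega
    zify [show d ≤ a * w by omega]
    ring
  have h3 : (b : ℝ) * c ≤ (q : ℝ) ^ ((k + d) * k +
      ((k + d - k) * w * a + (k + d) * w * (a + s - a))) := by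
    rw [pow_add, pow_add]
    exact_mod_cast h1
  have hg := gaussConst_pos
  refine le_of_mul_le_mul_left ?_ (by positivity : (0 : ℝ) < (q : ℝ) ^ (k * k))
  calc (q : ℝ) ^ (k * k) * (b * (q : ℝ) ^ (k * (a * w + k - (k + d))))
      ≤ (gaussConst * c) * (b * (q : ℝ) ^ (k * (a * w + k - (k + d)))) := by gcongr
    _ = gaussConst * ((q : ℝ) ^ (k * (a * w + k - (k + d))) * (b * c)) := by ring
    _ ≤ gaussConst * ((q : ℝ) ^ (k * (a * w + k - (k + d))) * (q : ℝ) ^ ((k + d) * k +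
      ((k + d - k) * w * a + (k + d) * w * (a + s - a)))) := by gcongr
    _ = (q : ℝ) ^ (k * k) *
        (gaussConst * ((q ^ ((k + d) * w * (a + s)) : ℕ) : ℝ)) := by
      rw [← pow_add, hexp]
      push_cast
      ring

end BadBound

/-! ### From maps with small common kernels to a network code. -/

section Solution

open Module

variable {F : Type*} [Field F] {ε ℓ h r α t : ℕ}

/-- A linear map whose kernel is small can be completed to an injective one. -/
theorem exists_linearMap_disjoint_ker {V : Type*} [AddCommGroup V] [Module F V]
    [FiniteDimensional F V] (K : Submodule F V) (hK : finrank F K ≤ ε * t) :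
    ∃ D : V →ₗ[F] (Fin ε → Fin t → F), ∀ x ∈ K, D x = 0 → x = 0 := by
  obtain ⟨f, hf⟩ : ∃ f : K →ₗ[F] (Fin ε → Fin t → F), Function.Injective f := by
    have hle : finrank F K ≤ finrank F (Fin ε → Fin t → F) := by
      simpa [finrank_pi_fintype] using hK
    exact ⟨(finBasis F K).constr ℕ (finBasis F (Fin ε → Fin t → F) ∘ Fin.castLE hle),
      (finBasis F K).injective_constr_of_linearIndependent
      ((finBasis F (Fin ε → Fin t → F)).linearIndependent.comp _ (Fin.castLE_injective hle))⟩
  obtain ⟨g, hg⟩ := LinearMap.exists_extend f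
  refine ⟨g, fun x hx h0 => ?_⟩
  have h1 : f ⟨x, hx⟩ = 0 := by rw [← hg]; exact h0
  have h2 : (⟨x, hx⟩ : K) = 0 := hf (by rw [h1, map_zero])
  exact congrArg Subtype.val h2

open GenCombNetwork in
/-- The symbols on the links when middle node `i` gets `A i x` and forwards it. -/
def forwardingFlow (A : Fin r → (Fin h → Fin t → F) →ₗ[F] (Fin ℓ → Fin t → F))
    (D : Receiver α r → (Fin h → Fin t → F) →ₗ[F] (Fin ε → Fin t → F)) :
    Edge ε ℓ α r → ((Fin h → Fin t → F) →ₗ[F] (Fin t → F))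
  | .toMiddle i j => LinearMap.proj j ∘ₗ A i
  | .toReceiver _ i _ j => LinearMap.proj j ∘ₗ A i
  | .direct S j => LinearMap.proj j ∘ₗ D S

open GenCombNetwork in
-- With `D S` injective on the common kernel, the symbols entering `S` determine `x`, and a linear
-- left inverse decodes.
theorem hasLinearSolution_of_finrank_le
    (A : Fin r → (Fin h → Fin t → F) →ₗ[F] (Fin ℓ → Fin t → F))
    (hA : ∀ S : Finset (Fin r), S.card = α →
      finrank F (⨅ i ∈ S, LinearMap.ker (A i) : Submodule F (Fin h → Fin t → F)) ≤ ε * t) :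
    (genCombNetwork ε ℓ h r α).HasLinearSolution F t := by
  choose D hD using fun S : Receiver α r => exists_linearMap_disjoint_ker _ (hA S.1 S.2)
  let N := genCombNetwork ε ℓ h r α
  have hloc : ∀ e : N.Edge, N.tail e ≠ N.source →
      ∃ f : (N.In (N.tail e) → Fin t → F) →ₗ[F] (Fin t → F),
        ∀ x, forwardingFlow A D e x = f fun e' => forwardingFlow A D e'.1 x := by
    rintro (⟨i, j⟩ | ⟨S, i, hi, j⟩ | ⟨S, j⟩) he
    · exact absurd rfl he
    · exact ⟨LinearMap.proj (⟨.toMiddle i j, rfl⟩ : N.In (N.tail (.toReceiver S i hi j))),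
        fun x => rfl⟩
    · exact absurd rfl he
  have hdec : ∀ v : N.Node, v ∈ N.receivers →
      ∃ g : (N.In v → Fin t → F) →ₗ[F] (Fin h → Fin t → F),
        ∀ x, g (fun e => forwardingFlow A D e.1 x) = x := by
    rintro _ ⟨S, rfl⟩
    let E : (Fin h → Fin t → F) →ₗ[F] (N.In (Node.receiver S) → Fin t → F) :=
      LinearMap.pi fun e => forwardingFlow A D e.1
    have hE : LinearMap.ker E = ⊥ := by
      refine (Submodule.eq_bot_iff _).2 fun x hx => ?_
      have hx' : ∀ e : N.In (Node.receiver S), forwardingFlow A D e.1 x = 0 :=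
        fun e => congrFun (LinearMap.mem_ker.1 hx) e
      refine hD S x ?_ (funext fun j => hx' ⟨.direct S j, rfl⟩)
      simp only [Submodule.mem_iInf, LinearMap.mem_ker]
      exact fun i hi => funext fun j => hx' ⟨.toReceiver S i hi j, rfl⟩
    obtain ⟨g, hg⟩ := E.exists_leftInverse_of_injective hE
    exact ⟨g, fun x => LinearMap.congr_fun hg x⟩
  choose loc hloc using hloc
  choose dec hdec using hdec
  exact ⟨{
    src := fun e _ => forwardingFlow A D e
    loc := loc
    dec := dec
    flow := fun x e => forwardingFlow A D e x
    flow_src := fun _ _ _ => rfl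
    flow_loc := fun x e he => hloc e he x
    recover := fun x v hv => hdec v hv x }⟩

end Solution

/-! ### The numerical condition of the local lemma. -/

section Numeric

/-- The hypothesis of the counting lemma at `y = m / (m + 1)`, where `m = α - 1`. -/
theorem choose_mul_le_of_pow_le (m r : ℕ) (hm : 1 ≤ m) (p Q γ : ℝ) (hγ : 0 < γ) (hQ : 0 < Q)
    (hp : p = γ / Q)
    (hr : (r : ℝ) ^ m ≤ (Nat.factorial m : ℝ) / (2 * Real.exp 1 * γ * (m + 1 : ℕ)) * Q) :
    ((r - 1).choose m : ℝ) * p ≤ (1 - (m / (m + 1) : ℝ)) * (m / (m + 1) : ℝ) ^ m := by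
  have hm0 : (0 : ℝ) < m := by exact_mod_cast hm
  -- This is (1 + 1/m)^m ≤ e, inverted.
  have he : (1 : ℝ) ≤ Real.exp 1 * (m / (m + 1) : ℝ) ^ m := by
    have h1 : ((m + 1) / m : ℝ) ^ m ≤ Real.exp 1 := by
      have h2 : ((m + 1) / m : ℝ) ≤ Real.exp (1 / m) := by
        have h3 := Real.add_one_le_exp (1 / m : ℝ)
        have h4 : ((m + 1) / m : ℝ) = 1 / m + 1 := by field_simp; ring
        rwa [h4]
      calc ((m + 1) / m : ℝ) ^ m ≤ Real.exp (1 / m) ^ m := by gcongr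
        _ = Real.exp 1 := by rw [← Real.exp_nat_mul, mul_one_div_cancel hm0.ne']
    have h5 : ((m + 1) / m : ℝ) ^ m * (m / (m + 1) : ℝ) ^ m = 1 := by
      rw [← mul_pow, div_mul_div_cancel₀ hm0.ne', div_self (by positivity), one_pow]
    refine h5.symm.le.trans ?_
    gcongr
  have hc : ((r - 1).choose m : ℝ) ≤ (r : ℝ) ^ m / Nat.factorial m :=
    (Nat.cast_le.2 (Nat.choose_le_choose m (Nat.sub_le r 1))).trans (Nat.choose_le_pow_div m r)
  have hfac : (0 : ℝ) < Nat.factorial m := by exact_mod_cast Nat.factorial_pos m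
  have he0 := Real.exp_pos 1
  calc ((r - 1).choose m : ℝ) * p
      ≤ ((Nat.factorial m : ℝ) / (2 * Real.exp 1 * γ * (m + 1 : ℕ)) * Q / Nat.factorial m) *
        (γ / Q) := by
        rw [hp]
        refine mul_le_mul_of_nonneg_right (hc.trans ?_) (by positivity)
        gcongr
    _ = 1 / (2 * Real.exp 1 * (m + 1)) := by
        push_cast
        field_simp
    -- The factor 2 in β is slack and is dropped here.
    _ ≤ 1 / (m + 1) * (1 / Real.exp 1) := by
        rw [one_div_mul_one_div]
        apply one_div_le_one_div_of_le (by positivity)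
        nlinarith [mul_pos he0 hm0]
    _ ≤ (1 - (m / (m + 1) : ℝ)) * (m / (m + 1) : ℝ) ^ m := by
        have : (1 - (m / (m + 1) : ℝ)) = 1 / (m + 1) := by field_simp; ring
        rw [this]
        gcongr
        rw [div_le_iff₀ he0]
        linarith

theorem pow_le_of_le_middleBeta (γ : ℝ) (hγ : 0 < γ) (m r q e : ℕ) (hm : 1 ≤ m) (f : ℝ)
    (hf : f = e) (hr : (r : ℝ) ≤
      middleBeta γ (m + 1) * (q : ℝ) ^ (f / (((m + 1 : ℕ) : ℝ) - 1))) :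
    (r : ℝ) ^ m ≤ (Nat.factorial m : ℝ) / (2 * Real.exp 1 * γ * (m + 1 : ℕ)) * (q : ℝ) ^ e := by
  have hm0 : (m : ℝ) ≠ 0 := by exact_mod_cast (by omega : m ≠ 0)
  have h1 : (((m + 1 : ℕ) : ℝ) - 1) = m := by push_cast; ring
  rw [middleBeta, h1, Nat.add_sub_cancel, hf] at hr
  refine (pow_le_pow_left₀ (Nat.cast_nonneg r) hr m).trans_eq ?_
  have he0 := Real.exp_pos 1
  rw [mul_pow, ← Real.rpow_natCast, ← Real.rpow_mul (by positivity), one_div_mul_cancel hm0,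
    Real.rpow_one, ← Real.rpow_natCast (((q : ℝ) ^ ((e : ℝ) / m))),
    ← Real.rpow_mul (Nat.cast_nonneg q), div_mul_cancel₀ _ hm0, Real.rpow_natCast]

end Numeric

theorem mainTheorem4 (γ : ℝ) (hγ : gaussConst ≤ γ)
    (α ε ℓ t h r q : ℕ) (hα : 2 ≤ α) (hℓ : 1 ≤ ℓ) (ht : 1 ≤ t) (hh : 1 ≤ h)
    (hhα : h ≤ α * ℓ + ε)
    (F : Type*) [Field F] [Fintype F] (hq : Fintype.card F = q)
    (hr : (r : ℝ) ≤
      middleBeta γ α * (q : ℝ) ^ (middleExponent α ℓ ε h t / ((α : ℝ) - 1))) :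
    (genCombNetwork ε ℓ h r α).HasLinearSolution F t := by
  subst hq
  obtain ⟨m, rfl⟩ : ∃ m, α = m + 1 := ⟨α - 1, by omega⟩
  have hm : 1 ≤ m := by omega
  have hγ0 : 0 < γ := gaussConst_pos.trans_le hγ
  have hq0 : (0 : ℝ) < Fintype.card F := by exact_mod_cast Fintype.card_pos
  have hV : Module.finrank F (Fin h → Fin t → F) = h * t := by simp [Module.finrank_pi_fintype]
  have hW : Module.finrank F (Fin ℓ → Fin t → F) = ℓ * t := by simp [Module.finrank_pi_fintype]
  have hdim : h * t ≤ (m + 1) * (ℓ * t) + (ε * t + 1) := by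
    have := Nat.mul_le_mul_right t hhα
    linarith
  -- The exponent k(αℓt + k - ht) at k = εt + 1, which expands to f(t).
  set e := (ε * t + 1) * ((m + 1) * (ℓ * t) + (ε * t + 1) - h * t) with he
  have hf : middleExponent (m + 1) ℓ ε h t = e := by
    rw [middleExponent, he, Nat.cast_mul, Nat.cast_sub hdim]
    push_cast
    ring
  have : Finite ((Fin h → Fin t → F) →ₗ[F] (Fin ℓ → Fin t → F)) := DFunLike.finite _
  have := Fintype.ofFinite ((Fin h → Fin t → F) →ₗ[F] (Fin ℓ → Fin t → F))
  have hQ : (0 : ℝ) < (Fintype.card F : ℝ) ^ e := by positivity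
  have hm0 : (0 : ℝ) < m := by exact_mod_cast hm
  obtain ⟨A, hA⟩ := exists_forall_not_bad
    (M := (Fin h → Fin t → F) →ₗ[F] (Fin ℓ → Fin t → F)) (ι := Fin r) (m + 1) (by omega)
    (fun S A => ε * t + 1 ≤ Module.finrank F
      (⨅ i ∈ S, LinearMap.ker (A i) : Submodule F (Fin h → Fin t → F)))
    (fun S A A' hAA hB => by
      have hK : (⨅ i ∈ S, LinearMap.ker (A i)) = ⨅ i ∈ S, LinearMap.ker (A' i) :=
        biInf_congr fun i hi => by rw [hAA i hi]
      rwa [hK] at hB)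
    -- `y = m / (m + 1)` maximises (1 - y) y^m.
    (γ / (Fintype.card F : ℝ) ^ e) (m / (m + 1)) (by positivity)
    (fun S hS => by
      have h1 := card_le_finrank_iInf_ker_mul_pow_le (F := F) (V := Fin h → Fin t → F)
        (W := Fin ℓ → Fin t → F) (ε * t + 1) S (by rw [hV, hW, hS]; exact hdim)
      rw [hV, hW, hS, ← he] at h1
      rw [div_mul_eq_mul_div, le_div_iff₀ hQ]
      exact h1.trans (mul_le_mul_of_nonneg_right hγ (Nat.cast_nonneg _)))
    (by positivity)
    (by
      rw [Fintype.card_fin, Nat.add_sub_cancel]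
      exact choose_mul_le_of_pow_le m r hm _ _ γ hγ0 hQ rfl
        (pow_le_of_le_middleBeta γ hγ0 m r _ e hm _ hf hr))
  exact hasLinearSolution_of_finrank_le A fun S hS => by
    have := hA S hS
    omega
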